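/- Let $(W,S)$ be a Coxeter system ($S$ not necessarily finite). For $X\subset S$ write $\langle X\rangle$ for the subgroup of $W$ generated by $X$ (a special subgroup), and let $lk_2(X)$ be the set of all $s\in S\setminus X$ that commute with every element of $X$ (so $lk_2(\emptyset)=S$). Let $B$ be an infinite subgroup of $W$ and let $A\subset S$ be such that $\langle A\rangle$ is contained in $B$ and has finite index in $B$. Then there are a subset $A_0\subset A$ and a finite subgroup $C$ of $\langle lk_2(A_0)\rangle$ such that $B$ is the internal direct product $B=\langle A_0\rangle\times C$. Moreover, there are a subset $D\subset lk_2(A_0)$ with $\langle D\rangle$ finite (so $D\subset S\setminus A_0$ and $D$ commutes with $A_0$) and an element $w\in\langle lk_2(A_0)\rangle$ such that $wCw^{-1}\subset\langle D\rangle$. -/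

import Mathlib

namespace CoxeterSystem

/-- The special subgroup `⟨A⟩` generated by the simple reflections indexed by `A`. -/
def special {I W : Type*} [Group W] {M : CoxeterMatrix I} (cs : CoxeterSystem M W)
    (A : Set I) : Subgroup W :=
  Subgroup.closure (cs.simple '' A)

/-- The 2-link of `A`: the generators outside `A` that commute with every generator in `A`.
In particular the 2-link of the empty set is the whole generating set. -/
def lk2 {I W : Type*} [Group W] {M : CoxeterMatrix I} (cs : CoxeterSystem M W)
    (A : Set I) : Set I :=
  {i | i ∉ A ∧ ∀ a ∈ A, Commute (cs.simple i) (cs.simple a)}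

end CoxeterSystem

/-- `B` is the internal direct product of its subgroups `H` and `K`. -/
structure Subgroup.IsInternalDirectProduct {G : Type*} [Group G] (B H K : Subgroup G) : Prop where
  commute : ∀ x ∈ H, ∀ y ∈ K, Commute x y
  disjoint : Disjoint H K
  sup_eq : H ⊔ K = B

/-! W acts on the space with basis the simple roots, preserving the form with entries `-cos (π / M i
j)`, and every root is nonnegative or nonpositive. The functional `coweight A` is ⟨A⟩-invariant, so
summing its translates over the finite set B/⟨A⟩ gives a B-invariant functional x. Each element of W
changes the sign of only finitely many positive roots; hence x is negative on only finitely many of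
them, and some u makes it dominant (`exists_dominant_translate`). The stabilizer of a dominant
functional is generated by the simple reflections fixing it (`mem_special_of_stabilizes_dominant`),
so u⁻¹Bu ≤ ⟨K⟩ for the set K of these reflections.

A functional vanishing on almost all roots of ⟨K⟩ is nonzero only at simple roots in components
generating a finite group (`exists_finite_component`). For `coweight A` moved by u this shows that,
outside such a part T of K, a shortest u carries simple roots to simple roots of A. By
`exists_mem_special_orthLink`, after discarding further finite components, u is a product of
generators orthogonal to the remaining set A₀. So u fixes the roots of A₀, whence A₀ ⊆ A, and K = A₀
∪ D with ⟨D⟩ finite and D orthogonal to A₀. Thus ⟨A₀⟩ ≤ B ≤ ⟨A₀⟩ × u⟨D⟩u⁻¹, and C = B ∩ u⟨D⟩u⁻¹ is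
the complement sought. -/

namespace CoxeterMatrix

/-! ### The geometric representation -/

open Module

variable {I : Type*} (M : CoxeterMatrix I)

/-- The simple root indexed by `i` in the geometric representation space. -/
noncomputable abbrev root (i : I) : I →₀ ℝ := Finsupp.single i 1

/-- The bilinear form of the geometric representation. -/
noncomputable def form : (I →₀ ℝ) →ₗ[ℝ] (I →₀ ℝ) →ₗ[ℝ] ℝ :=
  Finsupp.linearCombination ℝ fun i =>
    Finsupp.linearCombination ℝ fun j => -Real.cos (Real.pi / M i j)

/-- Infinite order is encoded by `M i j = 0`; then π/0 = 0 makes the value -1, as it should be. -/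
theorem form_root_root (i j : I) : M.form (root i) (root j) = -Real.cos (Real.pi / M i j) := by
  simp [form, root]

theorem form_root_self (i : I) : M.form (root i) (root i) = 1 := by
  simp [form_root_root]

theorem form_comm (u v : I →₀ ℝ) : M.form u v = M.form v u := by
  have : M.form = M.form.flip := by
    ext i j
    simp [form, M.symmetric i j]
  exact congrArg (fun b => b u v) this

theorem map_eq_sum (f : (I →₀ ℝ) →ₗ[ℝ] ℝ) (v : I →₀ ℝ) :
    f v = v.sum fun i c => c * f (root i) := by
  conv_lhs => rw [← Finsupp.sum_single v]
  rw [Finsupp.sum, map_sum]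
  refine Finset.sum_congr rfl fun i _ => ?_
  have : (Finsupp.single i (v i) : I →₀ ℝ) = v i • root i := by simp [root]
  rw [this, map_smul, smul_eq_mul]

theorem form_root_root_nonpos {i j : I} (h : i ≠ j) : M.form (root i) (root j) ≤ 0 := by
  rw [form_root_root, neg_nonpos]
  have h1 := M.off_diagonal i j h
  apply Real.cos_nonneg_of_neg_pi_div_two_le_of_le
  · have : 0 ≤ Real.pi / M i j := by positivity
    linarith [Real.pi_pos]
  · rcases Nat.eq_zero_or_pos (M i j) with h0 | h0
    · rw [h0, Nat.cast_zero, div_zero]; positivity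
    · have : (2 : ℝ) ≤ M i j := by exact_mod_cast (show 2 ≤ M i j by omega)
      exact div_le_div_of_nonneg_left Real.pi_pos.le two_pos this

theorem eq_two_of_form_eq_zero {i j : I} (h : M.form (root i) (root j) = 0) : M i j = 2 := by
  rw [form_root_root, neg_eq_zero] at h
  by_contra h2
  have h1 : M i j ≠ 1 := fun h1 => by simp [h1] at h
  rcases Nat.eq_zero_or_pos (M i j) with h0 | h0
  · simp [h0] at h
  · have h3 : (2 : ℝ) < M i j := by exact_mod_cast (show 2 < M i j by omega)
    refine (Real.cos_pos_of_mem_Ioo ⟨?_, ?_⟩).ne' h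
    · have : 0 ≤ Real.pi / M i j := by positivity
      linarith [Real.pi_pos]
    · exact div_lt_div_of_pos_left Real.pi_pos two_pos h3

/-- The reflection in the simple root indexed by `i`. -/
noncomputable def simpleRefl (i : I) : End ℝ (I →₀ ℝ) :=
  LinearMap.id - (M.form (root i)).smulRight ((2 : ℝ) • root i)

theorem simpleRefl_apply (i : I) (v : I →₀ ℝ) :
    M.simpleRefl i v = v - (2 * M.form (root i) v) • root i := by
  simp only [simpleRefl, LinearMap.sub_apply, LinearMap.id_apply, LinearMap.smulRight_apply,
    smul_smul, mul_comm]

theorem simpleRefl_mul_self (i : I) : M.simpleRefl i * M.simpleRefl i = 1 := by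
  refine LinearMap.ext fun v => ?_
  simp only [Module.End.mul_apply, Module.End.one_apply, simpleRefl_apply, map_sub, map_smul,
    form_root_self]
  module

/-- On the plane of the two roots the product is a rotation by 2θ. The factor sin θ avoids
denominators. -/
theorem sin_smul_simpleRefl_pow {i j : I} {θ : ℝ}
    (h : M.form (root i) (root j) = -Real.cos θ) (k : ℕ) :
    Real.sin θ • ((M.simpleRefl i * M.simpleRefl j) ^ k) (root i) =
        Real.sin ((2 * k + 1) * θ) • root i + Real.sin (2 * k * θ) • root j ∧
      Real.sin θ • ((M.simpleRefl i * M.simpleRefl j) ^ k) (root j) =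
        -Real.sin (2 * k * θ) • root i - Real.sin ((2 * k - 1) * θ) • root j := by
  have h' : M.form (root j) (root i) = -Real.cos θ := by rw [form_comm, h]
  have hi : (M.simpleRefl i * M.simpleRefl j) (root i) =
      (4 * Real.cos θ ^ 2 - 1) • root i + (2 * Real.cos θ) • root j := by
    simp only [Module.End.mul_apply, simpleRefl_apply, map_sub, map_smul, form_root_self,
      h, h']
    module
  have hj : (M.simpleRefl i * M.simpleRefl j) (root j) =
      (-2 * Real.cos θ) • root i - root j := by
    simp only [Module.End.mul_apply, simpleRefl_apply, map_sub, map_smul, form_root_self,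
      h]
    module
  induction k with
  | zero => simp
  | succ k ih =>
    obtain ⟨ih1, ih2⟩ := ih
    have hc := Real.sin_sq_add_cos_sq θ
    have e1 : Real.sin ((2 * (k + 1 : ℕ) + 1) * θ) =
        Real.sin ((2 * k + 1) * θ) * (4 * Real.cos θ ^ 2 - 1)
          - Real.sin (2 * k * θ) * (2 * Real.cos θ) := by
      have a1 : (2 * (k + 1 : ℕ) + 1) * θ = 2 * k * θ + 3 * θ := by push_cast; ring
      have a2 : (2 * k + 1) * θ = 2 * k * θ + θ := by ring
      rw [a1, a2, Real.sin_add, Real.sin_add, Real.sin_three_mul, Real.cos_three_mul]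
      linear_combination (-4 * Real.cos (2 * k * θ) * Real.sin θ) * hc
    have e2 : Real.sin (2 * (k + 1 : ℕ) * θ) =
        Real.sin ((2 * k + 1) * θ) * (2 * Real.cos θ) - Real.sin (2 * k * θ) := by
      have a1 : 2 * (k + 1 : ℕ) * θ = 2 * k * θ + 2 * θ := by push_cast; ring
      have a2 : (2 * k + 1) * θ = 2 * k * θ + θ := by ring
      rw [a1, a2, Real.sin_add, Real.sin_add, Real.sin_two_mul, Real.cos_two_mul]
      ring
    have e3 : Real.sin ((2 * (k + 1 : ℕ) - 1) * θ) = Real.sin ((2 * k + 1) * θ) := by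
      congr 1; push_cast; ring
    have e4 : Real.sin ((2 * k + 1) * θ) =
        2 * Real.cos θ * Real.sin (2 * k * θ) - Real.sin ((2 * k - 1) * θ) := by
      have a1 : (2 * k + 1) * θ = 2 * k * θ + θ := by ring
      have a2 : (2 * k - 1) * θ = 2 * k * θ - θ := by ring
      rw [a1, a2, Real.sin_add, Real.sin_sub]; ring
    constructor
    · rw [pow_succ, Module.End.mul_apply, hi, map_add, map_smul, map_smul, smul_add,
        smul_comm, ih1, smul_comm, ih2, e1, e2, e4]
      module
    · rw [pow_succ, Module.End.mul_apply, hj, map_sub, map_smul, smul_sub,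
        smul_comm, ih1, ih2, e2, e3, e4]
      module

theorem simpleRefl_isLiftable : M.IsLiftable M.simpleRefl := by
  intro i j
  rcases eq_or_ne i j with rfl | hij
  · rw [M.diagonal, pow_one, simpleRefl_mul_self]
  rcases Nat.eq_zero_or_pos (M i j) with h0 | h0
  · rw [h0, pow_zero]
  have h2 : (2 : ℝ) ≤ M i j := by
    have := M.off_diagonal i j hij
    exact_mod_cast (show 2 ≤ M i j by omega)
  set m := M i j with hm
  set θ := Real.pi / m with hθ
  have hs : Real.sin θ ≠ 0 := by
    refine (Real.sin_pos_of_pos_of_lt_pi (by positivity) ?_).ne'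
    exact div_lt_self Real.pi_pos (by linarith)
  have hform : M.form (root i) (root j) = -Real.cos θ := M.form_root_root i j
  have hform' : M.form (root j) (root i) = -Real.cos θ := by rw [form_comm, hform]
  have hmθ : 2 * m * θ = 2 * Real.pi := by
    rw [hθ]; field_simp
  obtain ⟨h1, h3⟩ := M.sin_smul_simpleRefl_pow hform m
  have hi : ((M.simpleRefl i * M.simpleRefl j) ^ m) (root i) = root i := by
    apply smul_right_injective _ hs
    simp only
    rw [h1, add_mul, hmθ, one_mul, add_comm _ θ, Real.sin_add_two_pi, Real.sin_two_pi]
    simp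
  have hj : ((M.simpleRefl i * M.simpleRefl j) ^ m) (root j) = root j := by
    apply smul_right_injective _ hs
    simp only
    rw [h3, sub_mul, hmθ, one_mul, Real.sin_two_pi_sub, Real.sin_two_pi]
    simp
  refine LinearMap.ext fun z => ?_
  set x := M.form (root i) z with hx
  set y := M.form (root j) z with hy
  set c := Real.cos θ with hc
  -- As sin θ ≠ 0, the form is nondegenerate on the plane. These coefficients make `q` orthogonal to
  -- both roots, hence fixed.
  set a := (x + c * y) / Real.sin θ ^ 2 with ha
  set b := (y + c * x) / Real.sin θ ^ 2 with hb
  have hsc : Real.sin θ ^ 2 = 1 - c ^ 2 := by rw [hc]; linarith [Real.sin_sq_add_cos_sq θ]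
  have hs2 : Real.sin θ ^ 2 ≠ 0 := pow_ne_zero 2 hs
  set q := z - a • root i - b • root j with hq
  have q1 : M.form (root i) q = 0 := by
    simp only [hq, map_sub, map_smul, form_root_self, hform, smul_eq_mul]
    rw [← hx, ha, hb]
    field_simp
    rw [hsc]; ring
  have q2 : M.form (root j) q = 0 := by
    simp only [hq, map_sub, map_smul, form_root_self, hform', smul_eq_mul]
    rw [← hy, ha, hb]
    field_simp
    rw [hsc]; ring
  have hfix : (M.simpleRefl i * M.simpleRefl j) q = q := by
    simp [Module.End.mul_apply, simpleRefl_apply, q1, q2]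
  have hfix' : ∀ k, ((M.simpleRefl i * M.simpleRefl j) ^ k) q = q := by
    intro k
    induction k with
    | zero => simp
    | succ k ih => rw [pow_succ, Module.End.mul_apply, hfix, ih]
  have hz : z = q + a • root i + b • root j := by rw [hq]; module
  rw [hz]
  simp only [map_add, map_smul, hfix', hi, hj, Module.End.one_apply]

end CoxeterMatrix

namespace CoxeterSystem

open Module CoxeterMatrix

variable {I W : Type*} [Group W] {M : CoxeterMatrix I} (cs : CoxeterSystem M W)

/-- The geometric representation of a Coxeter group. -/
noncomputable def geomRep : W →* End ℝ (I →₀ ℝ) :=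
  cs.lift ⟨M.simpleRefl, M.simpleRefl_isLiftable⟩

theorem geomRep_simple (i : I) (v : I →₀ ℝ) :
    cs.geomRep (cs.simple i) v = v - (2 * M.form (root i) v) • root i := by
  rw [geomRep, cs.lift_apply_simple, M.simpleRefl_apply]

theorem geomRep_mul (w w' : W) (v : I →₀ ℝ) :
    cs.geomRep (w * w') v = cs.geomRep w (cs.geomRep w' v) := by
  rw [map_mul, Module.End.mul_apply]

theorem geomRep_one (v : I →₀ ℝ) : cs.geomRep 1 v = v := by
  rw [map_one, Module.End.one_apply]

@[simp]
theorem geomRep_inv_geomRep (w : W) (v : I →₀ ℝ) :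
    cs.geomRep w⁻¹ (cs.geomRep w v) = v := by
  rw [← geomRep_mul, inv_mul_cancel, geomRep_one]

@[simp]
theorem geomRep_geomRep_inv (w : W) (v : I →₀ ℝ) :
    cs.geomRep w (cs.geomRep w⁻¹ v) = v := by
  rw [← geomRep_mul, mul_inv_cancel, geomRep_one]

theorem geomRep_injective (w : W) : Function.Injective (cs.geomRep w) :=
  Function.LeftInverse.injective (cs.geomRep_inv_geomRep w)

theorem geomRep_simple_root (i : I) : cs.geomRep (cs.simple i) (root i) = -root i := by
  rw [geomRep_simple, form_root_self]
  module

theorem form_geomRep (w : W) (u v : I →₀ ℝ) :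
    M.form (cs.geomRep w u) (cs.geomRep w v) = M.form u v := by
  induction w using cs.simple_induction_left generalizing u v with
  | one => simp
  | mul_simple_left w i ih =>
    rw [geomRep_mul, geomRep_mul, ← ih u v]
    simp only [geomRep_simple, map_sub, map_smul, LinearMap.sub_apply, LinearMap.smul_apply,
      form_root_self, smul_eq_mul, M.form_comm _ (root i)]
    ring

end CoxeterSystem

/-! ### Positivity of roots -/

namespace CoxeterSystem

open CoxeterMatrix

/-- The Chebyshev-type sequence `sin (k θ) / sin θ` as a function of `c = cos θ`. -/
noncomputable def sineRatio (c : ℝ) : ℕ → ℝ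
  | 0 => 0
  | 1 => 1
  | k + 2 => 2 * c * sineRatio c (k + 1) - sineRatio c k

theorem sineRatio_cos_mul_sin (θ : ℝ) (k : ℕ) :
    sineRatio (Real.cos θ) k * Real.sin θ = Real.sin (k * θ) := by
  induction k using Nat.twoStepInduction with
  | zero => simp [sineRatio]
  | one => simp [sineRatio]
  | more k ih1 ih2 =>
    rw [sineRatio, sub_mul, mul_assoc, ih1, ih2]
    have a1 : ((k + 1 : ℕ) : ℝ) * θ = k * θ + θ := by push_cast; ring
    have a2 : ((k + 2 : ℕ) : ℝ) * θ = k * θ + 2 * θ := by push_cast; ring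
    rw [a1, a2, Real.sin_add, Real.sin_add, Real.sin_two_mul, Real.cos_two_mul]
    ring

theorem sineRatio_one (k : ℕ) : sineRatio 1 k = k := by
  induction k using Nat.twoStepInduction with
  | zero => simp [sineRatio]
  | one => simp [sineRatio]
  | more k ih1 ih2 =>
    rw [sineRatio, ih1, ih2]; push_cast; ring

/-- The value is sin(kπ/m)/sin(π/m) with kπ/m in [0, π]; for m = 0 it is k. -/
theorem sineRatio_nonneg {m k : ℕ} (hm : m ≠ 1) (hk : m = 0 ∨ k ≤ m) :
    0 ≤ sineRatio (Real.cos (Real.pi / m)) k := by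
  rcases Nat.eq_zero_or_pos m with rfl | h0
  · simp [sineRatio_one]
  have h2 : (2 : ℝ) ≤ m := by exact_mod_cast (show 2 ≤ m by omega)
  have hs : 0 < Real.sin (Real.pi / m) :=
    Real.sin_pos_of_pos_of_lt_pi (by positivity) (div_lt_self Real.pi_pos (by linarith))
  refine nonneg_of_mul_nonneg_left ?_ hs
  rw [sineRatio_cos_mul_sin]
  apply Real.sin_nonneg_of_nonneg_of_le_pi (by positivity)
  have hk' : (k : ℝ) ≤ m := by exact_mod_cast (show k ≤ m by omega)
  calc (k : ℝ) * (Real.pi / m) ≤ m * (Real.pi / m) := by gcongr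
    _ = Real.pi := by field_simp

variable {I W : Type*} [Group W] {M : CoxeterMatrix I} (cs : CoxeterSystem M W)

theorem geomRep_alternatingWord_root (s t : I) (k : ℕ) :
    cs.geomRep (cs.wordProd (alternatingWord s t k)) (root s) =
      if Even k then
        sineRatio (Real.cos (Real.pi / M s t)) (k + 1) • root s +
          sineRatio (Real.cos (Real.pi / M s t)) k • root t
      else
        sineRatio (Real.cos (Real.pi / M s t)) (k + 1) • root t +
          sineRatio (Real.cos (Real.pi / M s t)) k • root s := by
  have hst := M.form_root_root s t
  have hts : M.form (root t) (root s) = -Real.cos (Real.pi / M s t) := by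
    rw [form_comm, hst]
  set c := Real.cos (Real.pi / M s t)
  induction k with
  | zero => simp [alternatingWord, sineRatio]
  | succ k ih =>
    rw [alternatingWord_succ', wordProd_cons, geomRep_mul, ih]
    by_cases hk : Even k
    · rw [if_pos hk, if_pos hk, if_neg (by simpa [Nat.even_add_one] using hk)]
      simp only [geomRep_simple, map_add, map_smul, form_root_self, hts, sineRatio]
      module
    · rw [if_neg hk, if_neg hk, if_pos (by simpa [Nat.even_add_one] using hk)]
      simp only [geomRep_simple, map_add, map_smul, form_root_self, hst, sineRatio]
      module

theorem root_nonneg (i : I) : (0 : I →₀ ℝ) ≤ root i := by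
  classical
  intro j
  simp only [Finsupp.coe_zero, Pi.zero_apply, root, Finsupp.single_apply]
  split_ifs <;> norm_num

/-- Split off from w a longest alternating suffix in s and a descent t. The remaining prefix v
lengthens under both s and t, so induction applies to it, and the dihedral suffix sends root s to a
nonnegative combination of roots s and t. -/
theorem geomRep_root_nonneg {w : W} {s : I} (h : cs.length w < cs.length (w * cs.simple s)) :
    0 ≤ cs.geomRep w (root s) := by
  induction hn : cs.length w using Nat.strong_induction_on generalizing w s with
  | _ n ih =>
  subst hn
  rcases eq_or_ne w 1 with rfl | hw
  · rw [geomRep_one]; exact root_nonneg s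
  obtain ⟨t, ht⟩ := cs.exists_rightDescent_of_ne_one hw
  have hst : s ≠ t := fun e => by subst e; exact lt_asymm h ht
  rw [isRightDescent_iff] at ht
  obtain ⟨k, hk1, ⟨v, hwv, hlen⟩, hmax⟩ : ∃ k, 1 ≤ k ∧
      (∃ v, w = v * cs.wordProd (alternatingWord s t k) ∧ cs.length w = cs.length v + k) ∧
      ¬ ∃ v, w = v * cs.wordProd (alternatingWord s t (k + 1)) ∧
        cs.length w = cs.length v + (k + 1) := by
    by_contra hcon
    push Not at hcon
    have hall : ∀ k, 1 ≤ k → ∃ v, w = v * cs.wordProd (alternatingWord s t k) ∧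
        cs.length w = cs.length v + k := by
      intro k hk
      induction k, hk using Nat.le_induction with
      | base => exact ⟨w * cs.simple t, by simp [alternatingWord], ht.symm⟩
      | succ k hk ihk => exact hcon k hk ihk
    obtain ⟨v, -, hv⟩ := hall (cs.length w + 1) (by omega)
    omega
  -- Otherwise the suffix could be extended by one letter.
  have hhead : cs.length v < cs.length (v * cs.simple (if Even k then t else s)) := by
    rcases cs.length_mul_simple v (if Even k then t else s) with h1 | h1
    · omega
    · refine absurd ⟨v * cs.simple (if Even k then t else s), ?_, by omega⟩ hmax
      rw [alternatingWord_succ', wordProd_cons, ← mul_assoc, simple_mul_simple_cancel_right]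
      exact hwv
  obtain ⟨k, rfl⟩ : ∃ k', k = k' + 1 := ⟨k - 1, by omega⟩
  -- Otherwise the first letter of the suffix would be absorbed by v, making w too short.
  have hhead' : cs.length v < cs.length (v * cs.simple (if Even k then t else s)) := by
    rcases cs.length_mul_simple v (if Even k then t else s) with h1 | h1
    · omega
    · rw [alternatingWord_succ', wordProd_cons, ← mul_assoc] at hwv
      have h2 := cs.length_mul_le (v * cs.simple (if Even k then t else s))
        (cs.wordProd (alternatingWord s t k))
      have h3 := cs.length_wordProd_le (alternatingWord s t k)
      rw [length_alternatingWord] at h3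
      rw [← hwv] at h2
      omega
  have hboth : cs.length v < cs.length (v * cs.simple s) ∧
      cs.length v < cs.length (v * cs.simple t) := by
    by_cases hk : Even k
    · rw [if_pos hk] at hhead'
      rw [if_neg (by simpa [Nat.even_add_one] using hk)] at hhead
      exact ⟨hhead, hhead'⟩
    · rw [if_neg hk] at hhead'
      rw [if_pos (by simpa [Nat.even_add_one] using hk)] at hhead
      exact ⟨hhead', hhead⟩
  have hvs := ih _ (by omega) hboth.1 rfl
  have hvt := ih _ (by omega) hboth.2 rfl
  -- A longer suffix followed by s would be a non-reduced alternating word, contradicting that s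
  -- lengthens w.
  have hkm : M s t = 0 ∨ k + 1 + 1 ≤ M s t := by
    by_contra! hcon
    have hred := cs.not_isReduced_alternatingWord t s (m := k + 1 + 1)
      (by rw [M.symmetric]; exact hcon.1) (by rw [M.symmetric]; exact hcon.2)
    have h3 := cs.length_wordProd_le (alternatingWord t s (k + 1 + 1))
    rw [IsReduced] at hred
    have h4 : w * cs.simple s = v * cs.wordProd (alternatingWord t s (k + 1 + 1)) := by
      rw [alternatingWord_succ t s, wordProd_concat, ← mul_assoc, ← hwv]
    have h5 := cs.length_mul_le v (cs.wordProd (alternatingWord t s (k + 1 + 1)))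
    rw [← h4] at h5
    rw [length_alternatingWord] at h3 hred
    omega
  have hm1 := M.off_diagonal s t hst
  have u1 : 0 ≤ sineRatio (Real.cos (Real.pi / M s t)) (k + 1) :=
    sineRatio_nonneg hm1 (by omega)
  have u2 : 0 ≤ sineRatio (Real.cos (Real.pi / M s t)) (k + 1 + 1) := sineRatio_nonneg hm1 hkm
  rw [hwv, geomRep_mul, geomRep_alternatingWord_root]
  split_ifs
  · rw [map_add, map_smul, map_smul]
    exact add_nonneg (smul_nonneg u2 hvs) (smul_nonneg u1 hvt)
  · rw [map_add, map_smul, map_smul]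
    exact add_nonneg (smul_nonneg u2 hvt) (smul_nonneg u1 hvs)

theorem geomRep_root_nonpos {w : W} {s : I} (h : cs.length (w * cs.simple s) < cs.length w) :
    cs.geomRep w (root s) ≤ 0 := by
  have := cs.geomRep_root_nonneg (w := w * cs.simple s) (s := s) (by simpa using h)
  rw [geomRep_mul, geomRep_simple_root, map_neg] at this
  exact neg_nonneg.1 this

/-! ### Roots of special subgroups -/

/-- The roots of the special subgroup `⟨K⟩`. -/
def rootsOf (K : Set I) : Set (I →₀ ℝ) :=
  {β | ∃ w ∈ cs.special K, ∃ k ∈ K, cs.geomRep w (root k) = β}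

theorem simple_mem_special {K : Set I} {k : I} (hk : k ∈ K) : cs.simple k ∈ cs.special K :=
  Subgroup.subset_closure ⟨k, hk, rfl⟩

theorem special_mono {K L : Set I} (h : K ⊆ L) : cs.special K ≤ cs.special L :=
  Subgroup.closure_mono (Set.image_mono h)

theorem special_univ : cs.special Set.univ = ⊤ := by
  rw [special, Set.image_univ, cs.subgroup_closure_range_simple]

variable {cs} {K : Set I} {β : I →₀ ℝ}

theorem rootsOf_mono {L : Set I} (h : K ⊆ L) : cs.rootsOf K ⊆ cs.rootsOf L := by
  rintro _ ⟨w, hw, k, hk, rfl⟩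
  exact ⟨w, cs.special_mono h hw, k, h hk, rfl⟩

theorem rootsOf_subset_univ : cs.rootsOf K ⊆ cs.rootsOf Set.univ :=
  rootsOf_mono (Set.subset_univ K)

theorem root_mem_rootsOf {k : I} (hk : k ∈ K) : root k ∈ cs.rootsOf K :=
  ⟨1, one_mem _, k, hk, cs.geomRep_one _⟩

theorem geomRep_mem_rootsOf {w : W} (hw : w ∈ cs.special K) (hβ : β ∈ cs.rootsOf K) :
    cs.geomRep w β ∈ cs.rootsOf K := by
  obtain ⟨v, hv, k, hk, rfl⟩ := hβ
  exact ⟨w * v, mul_mem hw hv, k, hk, cs.geomRep_mul _ _ _⟩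

theorem geomRep_mem_rootsOf_univ (w : W) (hβ : β ∈ cs.rootsOf Set.univ) :
    cs.geomRep w β ∈ cs.rootsOf Set.univ :=
  geomRep_mem_rootsOf (by simp [special_univ]) hβ

theorem neg_mem_rootsOf (hβ : β ∈ cs.rootsOf K) : -β ∈ cs.rootsOf K := by
  obtain ⟨v, hv, k, hk, rfl⟩ := hβ
  refine ⟨v * cs.simple k, mul_mem hv (cs.simple_mem_special hk), k, hk, ?_⟩
  rw [geomRep_mul, geomRep_simple_root, map_neg]

theorem form_self_of_mem_rootsOf (hβ : β ∈ cs.rootsOf K) : M.form β β = 1 := by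
  obtain ⟨v, hv, k, hk, rfl⟩ := hβ
  rw [form_geomRep, form_root_self]

theorem ne_zero_of_mem_rootsOf (hβ : β ∈ cs.rootsOf K) : β ≠ 0 := by
  rintro rfl
  simpa using form_self_of_mem_rootsOf hβ

theorem nonneg_or_nonpos_of_mem_rootsOf (hβ : β ∈ cs.rootsOf K) : 0 ≤ β ∨ β ≤ 0 := by
  obtain ⟨v, hv, k, hk, rfl⟩ := hβ
  rcases (cs.length_mul_simple_ne v k).lt_or_gt with h | h
  · exact Or.inr (cs.geomRep_root_nonpos h)
  · exact Or.inl (cs.geomRep_root_nonneg h)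

theorem nonneg_iff_of_mem_rootsOf (hβ : β ∈ cs.rootsOf K) : 0 ≤ β ↔ ¬ β ≤ 0 :=
  ⟨fun h h' => ne_zero_of_mem_rootsOf hβ (le_antisymm h' h),
    fun h => (nonneg_or_nonpos_of_mem_rootsOf hβ).resolve_right h⟩

theorem nonneg_of_pos_apply (hβ : β ∈ cs.rootsOf K) {i : I} (hi : 0 < β i) : 0 ≤ β :=
  (nonneg_iff_of_mem_rootsOf hβ).2 fun h => (h i).not_gt hi

theorem nonpos_of_neg_apply (hβ : β ∈ cs.rootsOf K) {i : I} (hi : β i < 0) : β ≤ 0 :=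
  (nonneg_or_nonpos_of_mem_rootsOf hβ).resolve_left fun h => (h i).not_gt hi

variable (cs) in
theorem length_lt_iff_geomRep_root_nonneg (w : W) (s : I) :
    cs.length w < cs.length (w * cs.simple s) ↔ 0 ≤ cs.geomRep w (root s) := by
  refine ⟨cs.geomRep_root_nonneg, fun h => ?_⟩
  refine (cs.length_mul_simple_ne w s).lt_or_gt.resolve_left fun h' => ?_
  have hr : cs.geomRep w (root s) ∈ cs.rootsOf Set.univ :=
    geomRep_mem_rootsOf_univ w (root_mem_rootsOf (Set.mem_univ s))
  exact (nonneg_iff_of_mem_rootsOf hr).1 h (cs.geomRep_root_nonpos h')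

theorem geomRep_apply_of_notMem {w : W} (hw : w ∈ cs.special K) (v : I →₀ ℝ) {i : I}
    (hi : i ∉ K) : cs.geomRep w v i = v i := by
  induction hw using Subgroup.closure_induction generalizing v with
  | mem x hx =>
    obtain ⟨k, hk, rfl⟩ := hx
    have : k ≠ i := fun e => hi (e ▸ hk)
    simp [geomRep_simple, root, this]
  | one => rw [geomRep_one]
  | mul x y _ _ hx hy => rw [geomRep_mul, hx, hy]
  | inv x _ hx => rw [← hx (cs.geomRep x⁻¹ v), geomRep_geomRep_inv]

theorem apply_eq_zero_of_mem_rootsOf (hβ : β ∈ cs.rootsOf K) {i : I} (hi : i ∉ K) : β i = 0 := by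
  obtain ⟨v, hv, k, hk, rfl⟩ := hβ
  have : k ≠ i := fun e => hi (e ▸ hk)
  rw [geomRep_apply_of_notMem hv _ hi]
  simp [root, this]

theorem exists_reflection (hβ : β ∈ cs.rootsOf K) :
    ∃ r ∈ cs.special K, ∀ v, cs.geomRep r v = v - (2 * M.form β v) • β := by
  obtain ⟨w, hw, k, hk, rfl⟩ := hβ
  refine ⟨w * cs.simple k * w⁻¹,
    mul_mem (mul_mem hw (cs.simple_mem_special hk)) (inv_mem hw), fun v => ?_⟩
  rw [geomRep_mul, geomRep_mul, geomRep_simple, map_sub, map_smul, geomRep_geomRep_inv,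
    ← cs.form_geomRep w, geomRep_geomRep_inv]

/-- All right descents of an element of a special subgroup `⟨K⟩` belong to `K`. -/
theorem mem_of_isRightDescent {w : W} (hw : w ∈ cs.special K) {s : I}
    (hs : cs.IsRightDescent w s) : s ∈ K := by
  by_contra h
  have h1 := cs.geomRep_root_nonpos hs s
  rw [geomRep_apply_of_notMem hw _ h] at h1
  simp [root] at h1
  linarith

theorem eq_root_of_forall_apply_eq_zero (hβ : β ∈ cs.rootsOf K) (hpos : 0 ≤ β) {s : I}
    (h : ∀ i, i ≠ s → β i = 0) : β = root s := by
  have h1 : β = β s • root s := by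
    ext i
    rcases eq_or_ne i s with rfl | hi
    · simp [root]
    · rw [h i hi]; simp [root, hi.symm]
  have h2 := form_self_of_mem_rootsOf hβ
  rw [h1] at h2
  simp only [map_smul, LinearMap.smul_apply, form_root_self, smul_eq_mul, mul_one] at h2
  have h3 : β s = 1 := by
    have := hpos s
    simp only [Finsupp.coe_zero, Pi.zero_apply] at this
    nlinarith
  rw [h1, h3, one_smul]

/-- A positive root other than root s has a positive coordinate away from s; the reflection leaves
it unchanged, and it determines the sign. -/
theorem geomRep_simple_nonneg (hβ : β ∈ cs.rootsOf K) (hpos : 0 ≤ β) {s : I} (hne : β ≠ root s) :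
    0 ≤ cs.geomRep (cs.simple s) β := by
  obtain ⟨i, his, hi⟩ : ∃ i, i ≠ s ∧ β i ≠ 0 := by
    by_contra! h
    exact hne (eq_root_of_forall_apply_eq_zero hβ hpos h)
  refine nonneg_of_pos_apply (K := Set.univ)
    (geomRep_mem_rootsOf_univ _ (rootsOf_subset_univ hβ)) (i := i) ?_
  rw [geomRep_apply_of_notMem (K := {s}) (cs.simple_mem_special rfl) _ his]
  exact lt_of_le_of_ne (hpos i) (Ne.symm hi)

variable (cs) in
-- Passing from w to ws adds at most the inversion root s; the others are images under s of
-- inversions of w.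
theorem finite_inversions (w : W) :
    {β ∈ cs.rootsOf Set.univ | 0 ≤ β ∧ cs.geomRep w β ≤ 0}.Finite := by
  induction w using cs.simple_induction_right with
  | one =>
    refine Set.finite_empty.subset ?_
    rintro β ⟨hβ, h1, h2⟩
    rw [geomRep_one] at h2
    exact (nonneg_iff_of_mem_rootsOf hβ).1 h1 h2
  | mul_simple_right w s ih =>
    refine ((ih.image (cs.geomRep (cs.simple s))).insert (root s)).subset ?_
    rintro β ⟨hβ, h1, h2⟩
    rcases eq_or_ne β (root s) with rfl | hne
    · exact Set.mem_insert _ _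
    · refine Set.mem_insert_of_mem _ ⟨cs.geomRep (cs.simple s) β,
        ⟨geomRep_mem_rootsOf_univ _ hβ, geomRep_simple_nonneg hβ h1 hne, ?_⟩, ?_⟩
      · rwa [← geomRep_mul]
      · rw [← geomRep_mul, simple_mul_simple_self, geomRep_one]

end CoxeterSystem

namespace Subgroup

theorem mem_sup_of_commute {G : Type*} [Group G] {H K : Subgroup G}
    (h : ∀ x ∈ H, ∀ y ∈ K, Commute x y) {g : G} :
    g ∈ H ⊔ K ↔ ∃ x ∈ H, ∃ y ∈ K, x * y = g := by
  constructor
  · intro hg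
    have hc : ∀ (x : H) (y : K), Commute (H.subtype x) (K.subtype y) :=
      fun x y => h x x.2 y y.2
    have hr := MonoidHom.noncommCoprod_range H.subtype K.subtype hc
    rw [range_subtype, range_subtype] at hr
    rw [← hr] at hg
    obtain ⟨⟨x, y⟩, rfl⟩ := hg
    exact ⟨x, x.2, y, y.2, rfl⟩
  · rintro ⟨x, hx, y, hy, rfl⟩
    exact mul_mem (mem_sup_left hx) (mem_sup_right hy)

end Subgroup

/-! ### Dominant functionals and finite components -/

namespace CoxeterSystem

open CoxeterMatrix

variable {I W : Type*} [Group W] {M : CoxeterMatrix I} {cs : CoxeterSystem M W}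
variable {K : Set I} {f : (I →₀ ℝ) →ₗ[ℝ] ℝ}

theorem map_nonneg_of_dominant (hf : ∀ k ∈ K, 0 ≤ f (root k)) {v : I →₀ ℝ} (hv : 0 ≤ v)
    (hK : ∀ i, i ∉ K → v i = 0) : 0 ≤ f v := by
  rw [map_eq_sum]
  refine Finset.sum_nonneg fun i _ => ?_
  by_cases hi : i ∈ K
  · exact mul_nonneg (hv i) (hf i hi)
  · simp [hK i hi]

/-- At a right descent s, w sends root s to a nonpositive root, so invariance and dominance force
f(root s) = 0. Then s fixes f and can be stripped off. -/
theorem mem_special_of_stabilizes_dominant (hf : ∀ k ∈ K, 0 ≤ f (root k)) {w : W}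
    (hw : w ∈ cs.special K) (hfix : ∀ v, f (cs.geomRep w v) = f v) :
    w ∈ cs.special {k ∈ K | f (root k) = 0} := by
  induction hn : cs.length w using Nat.strong_induction_on generalizing w with
  | _ n ih =>
  subst hn
  rcases eq_or_ne w 1 with rfl | hw1
  · exact one_mem _
  obtain ⟨s, hs⟩ := cs.exists_rightDescent_of_ne_one hw1
  have hsK := mem_of_isRightDescent hw hs
  have hle := cs.geomRep_root_nonpos hs
  have hroot : cs.geomRep w (root s) ∈ cs.rootsOf K :=
    geomRep_mem_rootsOf hw (root_mem_rootsOf hsK)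
  have h1 : 0 ≤ f (-cs.geomRep w (root s)) :=
    map_nonneg_of_dominant hf (neg_nonneg.2 hle) fun i hi => by
      rw [Finsupp.neg_apply, apply_eq_zero_of_mem_rootsOf hroot hi, neg_zero]
  rw [map_neg, hfix] at h1
  have h0 : f (root s) = 0 := le_antisymm (by linarith) (hf s hsK)
  have hmem := ih _ hs (mul_mem hw (cs.simple_mem_special hsK)) (fun v => by
    rw [geomRep_mul, hfix, geomRep_simple, map_sub, map_smul, h0, smul_zero, sub_zero]) rfl
  have := mul_mem hmem (cs.simple_mem_special (K := {k ∈ K | f (root k) = 0}) ⟨hsK, h0⟩)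
  rwa [simple_mul_simple_cancel_right] at this

/-- If f(root i) < 0, composing with the reflection i lowers the number of positive roots with
negative value, since i permutes the positive roots other than root i. -/
theorem exists_dominant_translate (f : (I →₀ ℝ) →ₗ[ℝ] ℝ)
    (hfin : {β ∈ cs.rootsOf Set.univ | 0 ≤ β ∧ f β < 0}.Finite) :
    ∃ w : W, ∀ i, 0 ≤ f (cs.geomRep w (root i)) := by
  induction hn : {β ∈ cs.rootsOf Set.univ | 0 ≤ β ∧ f β < 0}.ncard using
    Nat.strong_induction_on generalizing f with
  | _ n ih =>
  subst hn
  by_cases hdom : ∀ i, 0 ≤ f (root i)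
  · exact ⟨1, fun i => by rw [geomRep_one]; exact hdom i⟩
  push Not at hdom
  obtain ⟨i, hi⟩ := hdom
  have hss : ∀ v, cs.geomRep (cs.simple i) (cs.geomRep (cs.simple i) v) = v := fun v => by
    rw [← geomRep_mul, simple_mul_simple_self, geomRep_one]
  have hmem : root i ∈ {β ∈ cs.rootsOf Set.univ | 0 ≤ β ∧ f β < 0} :=
    ⟨root_mem_rootsOf (Set.mem_univ i), root_nonneg i, hi⟩
  have hsub : {β ∈ cs.rootsOf Set.univ |
        0 ≤ β ∧ (f ∘ₗ cs.geomRep (cs.simple i)) β < 0} ⊆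
      cs.geomRep (cs.simple i) ''
        ({β ∈ cs.rootsOf Set.univ | 0 ≤ β ∧ f β < 0} \ {root i}) := by
    rintro β ⟨hβ, h1, h2⟩
    rw [LinearMap.comp_apply] at h2
    refine ⟨cs.geomRep (cs.simple i) β, ⟨⟨geomRep_mem_rootsOf_univ _ hβ, ?_, h2⟩, ?_⟩, hss β⟩
    · refine geomRep_simple_nonneg hβ h1 ?_
      rintro rfl
      rw [geomRep_simple_root, map_neg] at h2
      linarith
    · intro h3
      rw [Set.mem_singleton_iff] at h3
      have h4 := hss β
      rw [h3, geomRep_simple_root] at h4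
      have h5 := h1 i
      rw [← h4] at h5
      simp [root] at h5
      linarith
  have hfin' := hfin.sdiff (t := {root i})
  obtain ⟨w, hw⟩ := ih _ (lt_of_le_of_lt ((Set.ncard_le_ncard hsub (hfin'.image _)).trans
    (Set.ncard_image_le hfin')) (Set.ncard_sdiff_singleton_lt_of_mem hmem hfin))
    (f ∘ₗ cs.geomRep (cs.simple i)) ((hfin'.image _).subset hsub) rfl
  exact ⟨cs.simple i * w, fun j => by rw [geomRep_mul]; exact hw j⟩

/-- An element of ⟨K⟩ is determined by its images of the simple roots in K: a nontrivial one has a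
descent in K and negates the sign there. -/
theorem finite_special_of_finite_rootsOf (hK : K.Finite) (hroots : (cs.rootsOf K).Finite) :
    Finite (cs.special K) := by
  have := hK.to_subtype
  have := hroots.to_subtype
  let φ : cs.special K → K → cs.rootsOf K := fun w k =>
    ⟨cs.geomRep w (root k), geomRep_mem_rootsOf w.2 (root_mem_rootsOf k.2)⟩
  refine Finite.of_injective φ fun w w' h => ?_
  have h1 : ∀ k ∈ K, cs.geomRep w (root k) = cs.geomRep w' (root k) := fun k hk =>
    congrArg Subtype.val (congrFun h ⟨k, hk⟩)
  have h2 : ∀ k ∈ K, cs.geomRep ((w'⁻¹ : W) * w) (root k) = root k := fun k hk => by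
    rw [geomRep_mul, h1 k hk, geomRep_inv_geomRep]
  by_contra hne
  have h3 : (w'⁻¹ : W) * w ≠ 1 := fun e => hne (Subtype.ext (inv_mul_eq_one.1 e).symm)
  obtain ⟨s, hs⟩ := cs.exists_rightDescent_of_ne_one h3
  have hsK := mem_of_isRightDescent (mul_mem (inv_mem w'.2) w.2) hs
  have h4 := cs.geomRep_root_nonpos hs
  rw [h2 s hsK] at h4
  have h5 := h4 s
  simp [root] at h5
  linarith

/-- If δ is not orthogonal to β, the reflection in β changes f(δ), so f is nonzero at δ or at its
reflection. -/
theorem finite_setOf_form_ne_zero (hfin : {β ∈ cs.rootsOf K | f β ≠ 0}.Finite) {β : I →₀ ℝ}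
    (hβ : β ∈ cs.rootsOf K) (hfβ : f β ≠ 0) :
    {δ ∈ cs.rootsOf K | M.form δ β ≠ 0}.Finite := by
  obtain ⟨r, hr, hrv⟩ := exists_reflection hβ
  refine (hfin.union (hfin.preimage (cs.geomRep_injective r).injOn)).subset ?_
  rintro δ ⟨hδ, hne⟩
  by_cases hf : f δ = 0
  · refine Or.inr ⟨geomRep_mem_rootsOf hr hδ, ?_⟩
    rw [hrv, map_sub, map_smul, hf, M.form_comm β δ]
    simp [hne, hfβ]
  · exact Or.inl ⟨hδ, hf⟩

/-- If a linear functional vanishes on all but finitely many roots of `⟨K⟩`, then the simple roots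
in `K` on which it does not vanish are contained in a union `T` of components of `K` which
generates a finite group. -/
theorem exists_finite_component (hfin : {β ∈ cs.rootsOf K | f β ≠ 0}.Finite) :
    ∃ T ⊆ K, (∀ k ∈ K, f (root k) ≠ 0 → k ∈ T) ∧
      (∀ t ∈ T, ∀ k ∈ K, k ∉ T → M.form (root t) (root k) = 0) ∧ Finite (cs.special T) := by
  let R : I → I → Prop := fun a b => b ∈ K ∧ M.form (root a) (root b) ≠ 0
  let T : Set I := {t | ∃ u ∈ K, f (root u) ≠ 0 ∧ Relation.ReflTransGen R u t}
  have hTK : T ⊆ K := by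
    rintro t ⟨u, hu, -, hut⟩
    rcases hut.cases_tail with rfl | ⟨c, -, hc⟩
    · exact hu
    · exact hc.1
  -- Nonvanishing spreads along edges: reflecting in a new vertex c with f(root c) = 0 preserves
  -- f(β) and adds c to the support. Finitely many such β, each of finite support, then cover T.
  have hsupp : ∀ t ∈ T, ∃ β ∈ cs.rootsOf K, 0 ≤ β ∧ f β ≠ 0 ∧ β t ≠ 0 := by
    rintro t ⟨u, hu, hfu, hut⟩
    induction hut with
    | refl => exact ⟨root u, root_mem_rootsOf hu, root_nonneg u, hfu, by simp [root]⟩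
    | @tail b c hub hbc ih =>
      obtain ⟨β, hβ, hpos, hfβ, hβb⟩ := ih
      by_cases hβc : β c = 0
      · by_cases hfc : f (root c) = 0
        · have hform : M.form (root c) β < 0 := by
            rw [map_eq_sum]
            have hterm : ∀ i ∈ β.support, β i * M.form (root c) (root i) ≤ 0 := by
              intro i hi
              refine mul_nonpos_of_nonneg_of_nonpos (hpos i) (M.form_root_root_nonpos ?_)
              rintro rfl
              exact (Finsupp.mem_support_iff.1 hi) hβc
            refine Finset.sum_neg' hterm ⟨b, Finsupp.mem_support_iff.2 hβb, ?_⟩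
            refine lt_of_le_of_ne (hterm b (Finsupp.mem_support_iff.2 hβb)) ?_
            change β b * M.form (root c) (root b) ≠ 0
            rw [M.form_comm]
            exact mul_ne_zero hβb hbc.2
          have hc : cs.geomRep (cs.simple c) β c ≠ 0 := by
            rw [geomRep_simple]
            simp [root, hβc, hform.ne]
          refine ⟨cs.geomRep (cs.simple c) β,
            geomRep_mem_rootsOf (cs.simple_mem_special hbc.1) hβ, ?_, ?_, hc⟩
          · refine geomRep_simple_nonneg hβ hpos ?_
            rintro rfl
            simp [root] at hβc
          · rw [geomRep_simple, map_sub, map_smul, hfc, smul_zero, sub_zero]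
            exact hfβ
        · exact ⟨root c, root_mem_rootsOf hbc.1, root_nonneg c, hfc, by simp [root]⟩
      · exact ⟨β, hβ, hpos, hfβ, hβc⟩
  have hTfin : T.Finite := by
    refine (hfin.biUnion fun β _ => (β.support.finite_toSet)).subset fun t ht => ?_
    obtain ⟨β, hβ, -, hfβ, hβt⟩ := hsupp t ht
    exact Set.mem_biUnion (show β ∈ {β ∈ cs.rootsOf K | f β ≠ 0} from ⟨hβ, hfβ⟩)
      (Finsupp.mem_support_iff.2 hβt)
  have horbit : ∀ t ∈ T, ∃ w ∈ cs.special K, f (cs.geomRep w (root t)) ≠ 0 := by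
    rintro t ⟨u, hu, hfu, hut⟩
    induction hut with
    | refl => exact ⟨1, one_mem _, by rwa [geomRep_one]⟩
    | @tail b c hub hbc ih =>
      obtain ⟨w, hw, hfw⟩ := ih
      by_cases hfc : f (cs.geomRep w (root c)) = 0
      · have hbK : b ∈ K := hTK ⟨u, hu, hfu, hub⟩
        refine ⟨w * cs.simple b, mul_mem hw (cs.simple_mem_special hbK), ?_⟩
        rw [geomRep_mul, geomRep_simple, map_sub, map_smul, map_sub, map_smul, hfc]
        simp [hbc.2, hfw]
      · exact ⟨w, hw, hfc⟩
  have hdeg : ∀ t ∈ T, {δ ∈ cs.rootsOf K | M.form δ (root t) ≠ 0}.Finite := by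
    intro t ht
    obtain ⟨w, hw, hfw⟩ := horbit t ht
    refine ((finite_setOf_form_ne_zero hfin
      (geomRep_mem_rootsOf hw (root_mem_rootsOf (hTK ht))) hfw).preimage
        (cs.geomRep_injective w).injOn).subset ?_
    rintro δ ⟨hδ, hne⟩
    exact ⟨geomRep_mem_rootsOf hw hδ, by rwa [form_geomRep]⟩
  -- A root of ⟨T⟩ has norm 1, so it is not orthogonal to every simple root in T.
  have hroots : (cs.rootsOf T).Finite := by
    refine (hTfin.biUnion hdeg).subset fun δ hδ => ?_
    have h1 := form_self_of_mem_rootsOf hδ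
    rw [map_eq_sum] at h1
    obtain ⟨t, -, ht⟩ := Finset.exists_ne_zero_of_sum_ne_zero
      (h1.trans_ne one_ne_zero)
    have htT : t ∈ T := by
      by_contra htT
      exact left_ne_zero_of_mul ht (apply_eq_zero_of_mem_rootsOf hδ htT)
    exact Set.mem_biUnion htT ⟨rootsOf_mono hTK hδ, right_ne_zero_of_mul ht⟩
  refine ⟨T, hTK, fun k hk hfk => ⟨k, hk, hfk, .refl⟩, ?_,
    finite_special_of_finite_rootsOf hTfin hroots⟩
  rintro t ⟨u, hu, hfu, hut⟩ k hk hkT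
  by_contra hne
  exact hkT ⟨u, hu, hfu, hut.tail ⟨hk, hne⟩⟩

variable (cs) in
theorem commute_of_form_eq_zero {i j : I} (h : M.form (root i) (root j) = 0) :
    Commute (cs.simple i) (cs.simple j) := by
  have h2 := cs.simple_mul_simple_pow i j
  rw [M.eq_two_of_form_eq_zero h, pow_two] at h2
  have := eq_inv_of_mul_eq_one_left h2
  rwa [mul_inv_rev, inv_simple, inv_simple] at this

variable (cs) in
theorem special_union (X Y : Set I) :
    cs.special (X ∪ Y) = cs.special X ⊔ cs.special Y := by
  rw [special, Set.image_union, Subgroup.closure_union, special, special]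

theorem commute_special {X Y : Set I}
    (h : ∀ x ∈ X, ∀ y ∈ Y, Commute (cs.simple x) (cs.simple y)) :
    ∀ x ∈ cs.special X, ∀ y ∈ cs.special Y, Commute x y := by
  have h1 : cs.special X ≤ Subgroup.centralizer (cs.special Y) := by
    rw [special, special, Subgroup.centralizer_closure, Subgroup.closure_le]
    rintro _ ⟨x, hx, rfl⟩
    rw [SetLike.mem_coe, Subgroup.mem_centralizer_iff]
    rintro _ ⟨y, hy, rfl⟩
    exact (h x hx y hy).symm
  intro x hx y hy
  exact ((Subgroup.mem_centralizer_iff.1 (h1 hx)) y hy).symm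

theorem finite_special_union {X Y : Set I} (hX : Finite (cs.special X))
    (hY : Finite (cs.special Y)) (h : ∀ x ∈ X, ∀ y ∈ Y, M.form (root x) (root y) = 0) :
    Finite (cs.special (X ∪ Y)) := by
  have hc := commute_special fun x hx y hy => cs.commute_of_form_eq_zero (h x hx y hy)
  have hfin := (Set.toFinite (cs.special X : Set W)).image2 (· * ·)
    (Set.toFinite (cs.special Y : Set W))
  refine (hfin.subset fun w hw => ?_).to_subtype
  rw [SetLike.mem_coe, special_union, Subgroup.mem_sup_of_commute hc] at hw
  obtain ⟨x, hx, y, hy, rfl⟩ := hw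
  exact ⟨x, hx, y, hy, rfl⟩

/-! ### Elements carrying simple roots to simple roots -/

/-- The generators outside `J` whose simple roots are orthogonal to all simple roots in `J`. -/
def _root_.CoxeterMatrix.orthLink (M : CoxeterMatrix I) (J : Set I) : Set I :=
  {i | i ∉ J ∧ ∀ j ∈ J, M.form (root i) (root j) = 0}

variable (cs) in
theorem orthLink_subset_lk2 (J : Set I) : M.orthLink J ⊆ cs.lk2 J :=
  fun _ hi => ⟨hi.1, fun j hj => cs.commute_of_form_eq_zero (hi.2 j hj)⟩

/-- If `v` maps the simple roots in `J` to simple roots and has `s` as a right descent, then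
`⟨J ∪ {s}⟩` has only finitely many roots with a nonzero coefficient at `s`, because `v` changes
the sign of each of them. -/
theorem finite_rootsOf_insert_of_isRightDescent {v : W} {J : Set I} {s : I}
    (hv : ∀ j ∈ J, ∃ i, cs.geomRep v (root j) = root i) (hs : cs.IsRightDescent v s) :
    {β ∈ cs.rootsOf (insert s J) | Finsupp.lapply (R := ℝ) s β ≠ 0}.Finite := by
  have hneg := cs.geomRep_root_nonpos hs
  have hsJ : s ∉ J := fun h => by
    obtain ⟨i, hi⟩ := hv s h
    rw [hi] at hneg
    have := hneg i
    simp [root] at this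
    linarith
  -- Otherwise v(root s) would be a combination of images of roots in J, and applying v⁻¹ would
  -- contradict s ∉ J.
  obtain ⟨r, hr, hrJ⟩ : ∃ r, cs.geomRep v (root s) r < 0 ∧
      ∀ j ∈ J, cs.geomRep v (root j) ≠ root r := by
    by_contra! hcon
    have h1 : (Finsupp.lapply (R := ℝ) s ∘ₗ cs.geomRep v⁻¹) (cs.geomRep v (root s)) = 1 := by
      simp [root, ← Module.End.mul_apply, ← map_mul]
    rw [map_eq_sum] at h1
    obtain ⟨r, hr, hne⟩ := Finset.exists_ne_zero_of_sum_ne_zero (h1.trans_ne one_ne_zero)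
    obtain ⟨j, hj, hjr⟩ := hcon r (lt_of_le_of_ne (hneg r) (Finsupp.mem_support_iff.1 hr))
    have hjs : j ≠ s := fun e => hsJ (e ▸ hj)
    apply right_ne_zero_of_mul hne
    rw [LinearMap.comp_apply, ← hjr, geomRep_inv_geomRep]
    simp [root, hjs]
  -- The coordinate of v(β) at r comes only from the s-term of β, hence is negative.
  have key : ∀ β ∈ cs.rootsOf (insert s J), 0 < β s → cs.geomRep v β ≤ 0 := by
    intro β hβ hβs
    refine nonpos_of_neg_apply (K := Set.univ)
      (geomRep_mem_rootsOf_univ v (rootsOf_subset_univ hβ)) (i := r) ?_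
    have h1 : cs.geomRep v β r = (Finsupp.lapply (R := ℝ) r ∘ₗ cs.geomRep v) β := rfl
    rw [h1, map_eq_sum, Finsupp.sum_eq_single s]
    · exact mul_neg_of_pos_of_neg hβs hr
    · intro i hi his
      have hiJ : i ∈ J := by
        by_contra hiJ
        exact hi (apply_eq_zero_of_mem_rootsOf hβ (by simp [his, hiJ]))
      obtain ⟨i', hi'⟩ := hv i hiJ
      have hne : i' ≠ r := fun e => hrJ i hiJ (e ▸ hi')
      rw [LinearMap.comp_apply, hi']
      simp [root, hne]
    · simp
  refine ((cs.finite_inversions v).union ((cs.finite_inversions v).preimage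
    neg_injective.injOn)).subset ?_
  rintro β ⟨hβ, hne⟩
  rw [Finsupp.lapply_apply] at hne
  rcases hne.lt_or_gt with h | h
  · refine Or.inr ⟨rootsOf_subset_univ (neg_mem_rootsOf hβ), ?_, ?_⟩
    · exact neg_nonneg.2 (nonpos_of_neg_apply hβ h)
    · exact key _ (neg_mem_rootsOf hβ) (by simpa using h)
  · exact Or.inl ⟨rootsOf_subset_univ hβ, nonneg_of_pos_apply hβ h, key β hβ h⟩

/-- If `v` maps the simple roots in `J` to simple roots, then up to components of `J` generating a
finite group, `v` is a product of generators orthogonal to `J`. -/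
theorem exists_mem_special_orthLink (v : W) (J : Set I)
    (hv : ∀ j ∈ J, ∃ i, cs.geomRep v (root j) = root i) :
    ∃ J₀ ⊆ J, (∀ a ∈ J \ J₀, ∀ b ∈ J₀, M.form (root a) (root b) = 0) ∧
      Finite (cs.special (J \ J₀)) ∧ v ∈ cs.special (M.orthLink J₀) := by
  induction hn : cs.length v using Nat.strong_induction_on generalizing v J with
  | _ n ih =>
  subst hn
  rcases eq_or_ne v 1 with rfl | hv1
  · refine ⟨J, subset_rfl, by simp, ?_, one_mem _⟩
    rw [Set.sdiff_self, special, Set.image_empty, Subgroup.closure_empty]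
    infer_instance
  obtain ⟨s, hs⟩ := cs.exists_rightDescent_of_ne_one hv1
  obtain ⟨T, hTK, hT, hTorth, hTfin⟩ :=
    exists_finite_component (finite_rootsOf_insert_of_isRightDescent hv hs)
  have hsT : s ∈ T := hT s (Set.mem_insert s J) (by simp [root])
  have hJT : ∀ t ∈ T, ∀ j ∈ J \ T, M.form (root t) (root j) = 0 :=
    fun t ht j hj => hTorth t ht j (Set.mem_insert_of_mem s hj.1) hj.2
  -- Since s ∈ T is orthogonal to J \ T, the shorter element vs agrees with v on those roots.
  obtain ⟨J₀, hJ₀, horth, hfin, hmem⟩ := ih _ hs (v * cs.simple s) (J \ T) (fun j hj => by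
    obtain ⟨i, hi⟩ := hv j hj.1
    refine ⟨i, ?_⟩
    rw [geomRep_mul, geomRep_simple, hJT s hsT j hj, mul_zero, zero_smul, sub_zero, hi]) rfl
  have hsplit : J \ J₀ = (J ∩ T) ∪ ((J \ T) \ J₀) := by
    ext i
    have := @hJ₀ i
    simp only [Set.mem_sdiff, Set.mem_union, Set.mem_inter_iff] at this ⊢
    tauto
  refine ⟨J₀, fun j hj => (hJ₀ hj).1, ?_, ?_, ?_⟩
  · rw [hsplit]
    rintro a (ha | ha) b hb
    · exact hJT a ha.2 b (hJ₀ hb)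
    · exact horth a ha b hb
  · rw [hsplit]
    refine finite_special_union ?_ hfin fun x hx y hy => hJT x hx.2 y hy.1
    exact Set.Finite.subset (Set.toFinite (cs.special T : Set W))
      (cs.special_mono Set.inter_subset_right)
  · have hsl : s ∈ M.orthLink J₀ :=
      ⟨fun h => (hJ₀ h).2 hsT, fun j hj => hJT s hsT j (hJ₀ hj)⟩
    have := mul_mem hmem (cs.simple_mem_special hsl)
    rwa [simple_mul_simple_cancel_right] at this

end CoxeterSystem

/-! ### Averaging over B and conjugating into a special subgroup -/

namespace CoxeterSystem

open CoxeterMatrix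

variable {I W : Type*} [Group W] {M : CoxeterMatrix I} {cs : CoxeterSystem M W}

/-- The functional which vanishes on the simple roots in `A` and is `1` on all other simple
roots. -/
noncomputable def coweight (A : Set I) : (I →₀ ℝ) →ₗ[ℝ] ℝ :=
  Finsupp.linearCombination ℝ (Aᶜ.indicator 1)

theorem coweight_root (A : Set I) (i : I) : coweight A (root i) = Aᶜ.indicator 1 i := by
  simp [coweight, root]

theorem coweight_nonneg (A : Set I) {v : I →₀ ℝ} (hv : 0 ≤ v) : 0 ≤ coweight A v := by
  refine map_nonneg_of_dominant (K := Set.univ) (fun k _ => ?_) hv (by simp)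
  rw [coweight_root]
  exact Set.indicator_nonneg (fun _ _ => zero_le_one) k

theorem apply_eq_zero_of_coweight_eq_zero {A : Set I} {v : I →₀ ℝ} (hv : 0 ≤ v)
    (h : coweight A v = 0) {i : I} (hi : i ∉ A) : v i = 0 := by
  rw [map_eq_sum, Finsupp.sum, Finset.sum_eq_zero_iff_of_nonneg] at h
  · by_contra hne
    have := h i (Finsupp.mem_support_iff.2 hne)
    rw [coweight_root, Set.indicator_of_mem hi, Pi.one_apply, mul_one] at this
    exact hne this
  · intro j _
    rw [coweight_root]
    exact mul_nonneg (hv j) (Set.indicator_nonneg (fun _ _ => zero_le_one) j)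

theorem coweight_geomRep {A : Set I} {w : W} (hw : w ∈ cs.special A) (v : I →₀ ℝ) :
    coweight A (cs.geomRep w v) = coweight A v := by
  rw [← sub_eq_zero, ← map_sub, map_eq_sum]
  refine Finset.sum_eq_zero fun i _ => ?_
  dsimp only
  rw [coweight_root]
  by_cases hi : i ∈ A
  · rw [Set.indicator_of_notMem (by simpa using hi), mul_zero]
  · rw [Finsupp.sub_apply, geomRep_apply_of_notMem hw v hi, sub_self, zero_mul]

variable (cs) in
/-- If `⟨A⟩` has finite index in `B`, then averaging the functional `coweight A` over `B` yields a
`B`-invariant functional which is negative on only finitely many positive roots, and the kernels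
of the two functionals contain the same roots up to finitely many exceptions. -/
theorem exists_invariant_functional (B : Subgroup W) (A : Set I)
    (hfin : ((cs.special A).subgroupOf B).FiniteIndex) :
    ∃ x : (I →₀ ℝ) →ₗ[ℝ] ℝ, (∀ b ∈ B, ∀ v, x (cs.geomRep b v) = x v) ∧
      {β ∈ cs.rootsOf Set.univ | 0 ≤ β ∧ x β < 0}.Finite ∧
      {β ∈ cs.rootsOf Set.univ | x β = 0 ∧ coweight A β ≠ 0}.Finite := by
  let H := (cs.special A).subgroupOf B
  have : Finite (B ⧸ H) := Subgroup.finite_quotient_of_finiteIndex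
  have := Fintype.ofFinite (B ⧸ H)
  let F : B ⧸ H → (I →₀ ℝ) →ₗ[ℝ] ℝ := fun q =>
    Quotient.liftOn' q (fun b => coweight A ∘ₗ cs.geomRep (b : W)⁻¹) (by
      intro b b' h
      rw [QuotientGroup.leftRel_apply] at h
      have h' : (b : W)⁻¹ * b' ∈ cs.special A := Subgroup.mem_subgroupOf.1 h
      refine LinearMap.ext fun v => ?_
      rw [LinearMap.comp_apply, LinearMap.comp_apply, ← coweight_geomRep h' (cs.geomRep (b' : W)⁻¹ v), ← geomRep_mul,
        mul_assoc, mul_inv_cancel, mul_one])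
  have hF : ∀ (b : B) v, F (b : B ⧸ H) v = coweight A (cs.geomRep (b : W)⁻¹ v) := fun _ _ => rfl
  have hx : ∀ v, (∑ q, F q) v = ∑ q, F q v := fun v => LinearMap.sum_apply _ _ _
  -- Outside this finite set all summands are nonnegative at a positive root. Hence so is the sum,
  -- and if it vanishes then so does `coweight A`, the summand of the trivial coset.
  let N := ⋃ q : B ⧸ H,
    {β ∈ cs.rootsOf Set.univ | 0 ≤ β ∧ cs.geomRep ((q.out : B) : W)⁻¹ β ≤ 0}
  have hN : N.Finite := Set.finite_iUnion fun q => cs.finite_inversions _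
  have hterm : ∀ β ∈ cs.rootsOf Set.univ, 0 ≤ β → β ∉ N → ∀ q, 0 ≤ F q β := by
    intro β hβ hpos hβN q
    rw [← QuotientGroup.out_eq' q, hF]
    refine coweight_nonneg A ((nonneg_or_nonpos_of_mem_rootsOf
      (geomRep_mem_rootsOf_univ _ hβ)).resolve_right fun h => hβN ?_)
    exact Set.mem_iUnion.2 ⟨q, hβ, hpos, h⟩
  have hzero : ∀ β ∈ cs.rootsOf Set.univ, 0 ≤ β → (∑ q, F q) β = 0 → coweight A β ≠ 0 →
      β ∈ N := by
    intro β hβ hpos hxβ hne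
    by_contra hβN
    rw [hx, Finset.sum_eq_zero_iff_of_nonneg fun q _ => hterm β hβ hpos hβN q] at hxβ
    have := hxβ ((1 : B) : B ⧸ H) (Finset.mem_univ _)
    rw [hF] at this
    simp only [OneMemClass.coe_one, inv_one, geomRep_one] at this
    exact hne this
  refine ⟨∑ q, F q, fun b hb v => ?_, ?_, ?_⟩
  · rw [hx, hx]
    refine Fintype.sum_equiv (MulAction.toPerm (⟨b, hb⟩⁻¹ : B)) _ _ fun q => ?_
    induction q using QuotientGroup.induction_on with
    | H b' =>
      rw [MulAction.toPerm_apply, MulAction.Quotient.smul_coe, hF, hF, ← geomRep_mul]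
      simp [mul_inv_rev]
  · refine hN.subset ?_
    rintro β ⟨hβ, hpos, hneg⟩
    by_contra hβN
    rw [hx] at hneg
    exact hneg.not_ge (Finset.sum_nonneg fun q _ => hterm β hβ hpos hβN q)
  · refine (hN.union (hN.preimage neg_injective.injOn)).subset ?_
    rintro β ⟨hβ, hxβ, hne⟩
    rcases nonneg_or_nonpos_of_mem_rootsOf hβ with h | h
    · exact Or.inl (hzero β hβ h hxβ hne)
    · refine Or.inr (hzero _ (neg_mem_rootsOf hβ) (neg_nonneg.2 h) ?_ ?_)
      · rw [map_neg, hxβ, neg_zero]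
      · rwa [map_neg, neg_ne_zero]

theorem geomRep_root_of_mem_special_orthLink {J : Set I} {w : W}
    (hw : w ∈ cs.special (M.orthLink J)) {j : I} (hj : j ∈ J) :
    cs.geomRep w (root j) = root j := by
  induction hw using Subgroup.closure_induction with
  | mem x hx =>
    obtain ⟨i, hi, rfl⟩ := hx
    rw [geomRep_simple, hi.2 j hj, mul_zero, zero_smul, sub_zero]
  | one => rw [geomRep_one]
  | mul x y _ _ hx hy => rw [geomRep_mul, hy, hx]
  | inv x _ hx => conv_lhs => rw [← hx, geomRep_inv_geomRep]

variable (cs) in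
theorem disjoint_special {X Y : Set I} (h : Disjoint X Y) :
    Disjoint (cs.special X) (cs.special Y) := by
  rw [Subgroup.disjoint_def]
  intro w hX hY
  by_contra hw
  obtain ⟨s, hs⟩ := cs.exists_rightDescent_of_ne_one hw
  exact Set.disjoint_left.1 h (mem_of_isRightDescent hX hs) (mem_of_isRightDescent hY hs)

/-- If `u` maps the simple root `t` to a nonnegative combination of simple roots in `A`, all of
which `u⁻¹` maps to positive roots, then `u` maps the simple root `t` to a simple root in `A`. -/
theorem exists_geomRep_root_eq_root {A : Set I} {u : W} {t : I}
    (hpos : 0 ≤ cs.geomRep u (root t)) (hA : ∀ i, i ∉ A → cs.geomRep u (root t) i = 0)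
    (hinv : ∀ a ∈ A, 0 ≤ cs.geomRep u⁻¹ (root a)) :
    ∃ a ∈ A, cs.geomRep u (root t) = root a := by
  have hroot : cs.geomRep u (root t) ∈ cs.rootsOf Set.univ :=
    geomRep_mem_rootsOf_univ u (root_mem_rootsOf (Set.mem_univ t))
  obtain ⟨a, ha⟩ := Finsupp.ne_iff.1 (ne_zero_of_mem_rootsOf hroot)
  have haA : a ∈ A := by
    by_contra h
    exact ha (hA a h)
  refine ⟨a, haA, ?_⟩
  have h1 : cs.geomRep u⁻¹ (root a) = root t := by
    refine eq_root_of_forall_apply_eq_zero (K := Set.univ)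
      (geomRep_mem_rootsOf_univ _ (root_mem_rootsOf (Set.mem_univ a))) (hinv a haA) fun i hi => ?_
    have h2 : (Finsupp.lapply (R := ℝ) i ∘ₗ cs.geomRep u⁻¹) (cs.geomRep u (root t)) = 0 := by
      rw [LinearMap.comp_apply, geomRep_inv_geomRep]
      simp [root, hi.symm]
    rw [map_eq_sum, Finsupp.sum, Finset.sum_eq_zero_iff_of_nonneg] at h2
    · exact (mul_eq_zero.1 (h2 a (Finsupp.mem_support_iff.2 ha))).resolve_left ha
    · intro j hj
      have hjA : j ∈ A := by
        by_contra h
        exact Finsupp.mem_support_iff.1 hj (hA j h)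
      exact mul_nonneg (hpos j) (hinv j hjA i)
  rw [← h1, geomRep_geomRep_inv]

/-- If `⟨A⟩` is a finite index subgroup of `B`, then some conjugate of `B` lies in a special
subgroup `⟨D⟩` which is a product of a special subgroup conjugate to `⟨A₀⟩` with `A₀ ⊆ A`, and of
a finite special subgroup. -/
theorem exists_conj_mem_special (B : Subgroup W) (A : Set I) (hAB : cs.special A ≤ B)
    (hfin : ((cs.special A).subgroupOf B).FiniteIndex) :
    ∃ (u : W) (K T : Set I), T ⊆ K ∧ (∀ b ∈ B, u⁻¹ * b * u ∈ cs.special K) ∧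
      (∀ t ∈ K \ T, ∃ a ∈ A, cs.geomRep u (root t) = root a) ∧
      (∀ t ∈ T, ∀ k ∈ K \ T, M.form (root t) (root k) = 0) ∧ Finite (cs.special T) := by
  obtain ⟨x, hxB, hxfin, hxA⟩ := cs.exists_invariant_functional B A hfin
  -- Right multiplication by generators in K and left multiplication by those in A preserve
  -- dominance. A shortest u therefore lengthens under both, which gives `hupos` and `hinv`.
  obtain ⟨u, hu, hmin⟩ := (measure cs.length).wf.has_min
    {u | ∀ i, 0 ≤ x (cs.geomRep u (root i))} (exists_dominant_translate x hxfin)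
  let K : Set I := {i | x (cs.geomRep u (root i)) = 0}
  have hupos : ∀ t ∈ K, 0 ≤ cs.geomRep u (root t) := by
    intro t ht
    rw [← length_lt_iff_geomRep_root_nonneg]
    refine (cs.length_mul_simple_ne u t).lt_or_gt.resolve_left fun h => hmin _ (fun i => ?_) h
    rw [geomRep_mul, geomRep_simple, map_sub, map_smul, map_sub, map_smul,
      show x (cs.geomRep u (root t)) = 0 from ht, smul_zero, sub_zero]
    exact hu i
  have hinv : ∀ a ∈ A, 0 ≤ cs.geomRep u⁻¹ (root a) := by
    intro a ha
    rw [← length_lt_iff_geomRep_root_nonneg]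
    refine (cs.length_mul_simple_ne u⁻¹ a).lt_or_gt.resolve_left fun h =>
      hmin (cs.simple a * u) (fun i => ?_) ?_
    · rw [geomRep_mul, hxB _ (hAB (cs.simple_mem_special ha))]
      exact hu i
    · rw [← cs.length_inv, cs.length_inv u] at h
      have h' : cs.length (cs.simple a * u) < cs.length u := by simpa using h
      exact h'
  have hKzero : ∀ β ∈ cs.rootsOf K, x (cs.geomRep u β) = 0 := by
    intro β hβ
    have h1 : x (cs.geomRep u β) = (x ∘ₗ cs.geomRep u) β := rfl
    rw [h1, map_eq_sum]
    refine Finset.sum_eq_zero fun i hi => ?_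
    have hiK : i ∈ K := by
      by_contra h
      exact Finsupp.mem_support_iff.1 hi (apply_eq_zero_of_mem_rootsOf hβ h)
    exact mul_eq_zero_of_right _ hiK
  have hfinK : {β ∈ cs.rootsOf K | (coweight A ∘ₗ cs.geomRep u) β ≠ 0}.Finite := by
    refine (hxA.preimage (cs.geomRep_injective u).injOn).subset ?_
    rintro β ⟨hβ, hne⟩
    exact ⟨geomRep_mem_rootsOf_univ u (rootsOf_subset_univ hβ), hKzero β hβ, hne⟩
  obtain ⟨T, hTK, hT, hTorth, hTfin⟩ := exists_finite_component hfinK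
  refine ⟨u, K, T, hTK, fun b hb => ?_, fun t ht => ?_,
    fun t ht k hk => hTorth t ht k hk.1 hk.2, hTfin⟩
  · have := mem_special_of_stabilizes_dominant (f := x ∘ₗ cs.geomRep u) (K := Set.univ)
      (fun i _ => hu i) (w := u⁻¹ * b * u) (by simp [special_univ]) fun v => by
        rw [LinearMap.comp_apply, geomRep_mul, geomRep_mul, geomRep_geomRep_inv, hxB b hb]
        rfl
    refine cs.special_mono ?_ this
    rintro i ⟨-, hi⟩
    exact hi
  · refine exists_geomRep_root_eq_root (hupos t ht.1) (fun i hi => ?_) hinv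
    refine apply_eq_zero_of_coweight_eq_zero (hupos t ht.1) ?_ hi
    by_contra hne
    exact ht.2 (hT t ht.1 hne)

end CoxeterSystem

/-! ### The direct product decomposition -/

theorem mainTheorem7 {I W : Type*} [Group W] {M : CoxeterMatrix I} (cs : CoxeterSystem M W)
    (B : Subgroup W) (hB : Infinite B) (A : Set I) (hAB : cs.special A ≤ B)
    (hfin : ((cs.special A).subgroupOf B).FiniteIndex) :
    ∃ A₀ : Set I, A₀ ⊆ A ∧ ∃ C : Subgroup W, Finite C ∧ C ≤ cs.special (cs.lk2 A₀) ∧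
      B.IsInternalDirectProduct (cs.special A₀) C ∧
      ∃ D : Set I, D ⊆ cs.lk2 A₀ ∧ Finite (cs.special D) ∧
        ∃ w ∈ cs.special (cs.lk2 A₀), ∀ c ∈ C, w * c * w⁻¹ ∈ cs.special D := by
  obtain ⟨u, K, T, hTK, hBK, huA, hTorth, hTfin⟩ :=
    CoxeterSystem.exists_conj_mem_special B A hAB hfin
  obtain ⟨A₀, hA₀, horth, hfin₀, hu⟩ := CoxeterSystem.exists_mem_special_orthLink u (K \ T)
    fun t ht => (huA t ht).imp fun _ h => h.2
  have hA₀A : A₀ ⊆ A := by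
    intro t ht
    obtain ⟨a, ha, hat⟩ := huA t (hA₀ ht)
    rw [CoxeterSystem.geomRep_root_of_mem_special_orthLink hu ht] at hat
    rwa [Finsupp.single_left_injective one_ne_zero hat]
  let D : Set I := T ∪ ((K \ T) \ A₀)
  have hD : D ⊆ cs.lk2 A₀ := by
    refine subset_trans ?_ (cs.orthLink_subset_lk2 A₀)
    rintro d (hd | hd)
    · exact ⟨fun h => (hA₀ h).2 hd, fun a ha => hTorth d hd a (hA₀ ha)⟩
    · exact ⟨hd.2, horth d hd⟩
  have hDfin : Finite (cs.special D) :=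
    CoxeterSystem.finite_special_union hTfin hfin₀ fun t ht k hk => hTorth t ht k hk.1
  have hK : K = A₀ ∪ D := by
    ext i
    have h1 := @hTK i
    have h2 := @hA₀ i
    simp only [D, Set.mem_union, Set.mem_sdiff] at h1 h2 ⊢
    tauto
  have hu' : u ∈ cs.special (cs.lk2 A₀) := cs.special_mono (cs.orthLink_subset_lk2 A₀) hu
  have hcomm : ∀ p ∈ cs.special A₀, ∀ q ∈ cs.special (cs.lk2 A₀), Commute p q :=
    CoxeterSystem.commute_special fun a ha i hi => (hi.2 a ha).symm
  -- This is B ∩ u⟨D⟩u⁻¹; conjugation by u⁻¹ embeds it in ⟨D⟩.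
  let C : Subgroup W := B ⊓ (cs.special D).comap (MulAut.conj u⁻¹).toMonoidHom
  have hC : ∀ c ∈ C, u⁻¹ * c * u⁻¹⁻¹ ∈ cs.special D := fun c hc => hc.2
  have hClk : C ≤ cs.special (cs.lk2 A₀) := by
    intro c hc
    have := mul_mem (mul_mem hu' (cs.special_mono hD (hC c hc))) (inv_mem hu')
    simpa [mul_assoc] using this
  refine ⟨A₀, hA₀A, C, ?_, hClk, ⟨?_, ?_, ?_⟩, D, hD, hDfin, u⁻¹, inv_mem hu', hC⟩
  · refine Finite.of_injective
      (fun c : C => (⟨u⁻¹ * c * u⁻¹⁻¹, hC c c.2⟩ : cs.special D)) fun c c' h => ?_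
    simpa using h
  · exact fun p hp c hc => hcomm p hp c (hClk hc)
  · refine Disjoint.mono_right hClk (cs.disjoint_special ?_)
    exact Set.disjoint_left.2 fun i hi hi' => hi'.1 hi
  · refine le_antisymm (sup_le ((cs.special_mono hA₀A).trans hAB) inf_le_left) fun b hb => ?_
    have hb' := hBK b hb
    rw [hK, CoxeterSystem.special_union, Subgroup.mem_sup_of_commute fun p hp q hq =>
      hcomm p hp q (cs.special_mono hD hq)] at hb'
    obtain ⟨p, hp, q, hq, hpq⟩ := hb'
    -- Since p commutes with u, b = u(pq)u⁻¹ splits this way; the second factor lies in B because p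
    -- does.
    have hbp : p * (u * q * u⁻¹) = b := by
      have h1 : p * u = u * p := hcomm p hp u hu'
      rw [← mul_assoc, ← mul_assoc, h1, mul_assoc u, hpq]
      group
    refine hbp ▸ mul_mem (Subgroup.mem_sup_left hp) (Subgroup.mem_sup_right ⟨?_, ?_⟩)
    · rw [← eq_inv_mul_iff_mul_eq] at hbp
      rw [hbp]
      exact B.mul_mem (B.inv_mem (hAB (cs.special_mono hA₀A hp))) hb
    · change u⁻¹ * (u * q * u⁻¹) * u⁻¹⁻¹ ∈ cs.special D
      convert hq using 1
      group
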